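/- Let $\mathbb N=\{1,2,3,\dots\}$ and let $\mathbb N_2$ be the set of unordered pairs $e=\{i,j\}$ of distinct elements of $\mathbb N$. Let $\gamma\in\mathbb R$ and let $\mu$ be a probability measure on $\mathbb N_2$ such that, for some constant $c$, $\mu_{ij}:=\mu(\{\{i,j\}\})=c\,(ij)^{-\gamma}$ for all $i\neq j$ (such a $\mu$ exists only if $\gamma>1$). *Discrete time.* Let $e_1,e_2,\dots$ be i.i.d. with law $\mu$, let $G_0$ be the empty graph, and let $G_{n+1}$ be the union of $G_n$ with the edge $e_{n+1}$ and its two endpoints ($n\ge 0$), parallel edges being identified. *Continuous time.* Let $(N_e(t))_{t\ge 0}$, $e\in\mathbb N_2$, be independent Poisson processes, $N_e$ with intensity $\mu_e:=\mu(\{e\})$. For $t\ge 0$ let $G_t$ be the graph whose edges are the $e$ with $N_e(t)>0$ and whose vertices are the endpoints of these edges. A graph-valued process $(G_s)_{s\in I}$ is said to be eventually forever connected, at a sample point $\omega$, if there is $i=i(\omega)\in I$ such that $G_s(\omega)$ is connected for all $s\in I$ with $s>i$. Then $(G_n)_{n\in\mathbb Z_{\ge 0}}$ is almost surely eventually forever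 connected if and only if $\gamma>2$, and likewise $(G_t)_{t\in[0,\infty)}$ is almost surely eventually forever connected if and only if $\gamma>2$. Moreover, if $\gamma\le 2$, then each of the two processes is almost surely not eventually forever connected. -/

import Mathlib

open MeasureTheory ProbabilityTheory
open scoped NNReal ENNReal

namespace EdgeGraph

/-- The set of unordered pairs of distinct natural numbers `1, 2, 3, …`. -/
def Edge : Type := {e : Sym2 ℕ+ // ¬ e.IsDiag}

/-- The edge `{i, j}`. -/
def Edge.mk (i j : ℕ+) (h : i ≠ j) : Edge := ⟨s(i, j), by simpa using h⟩

instance : Countable Edge := inferInstanceAs (Countable {e : Sym2 ℕ+ // ¬ e.IsDiag})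

/-- The set of edges is countable; all its subsets are measurable. -/
instance : MeasurableSpace Edge := ⊤

instance : DiscreteMeasurableSpace Edge := ⟨fun _ => trivial⟩

/-- A graph whose vertices are some of the natural numbers `1, 2, 3, …`, without parallel edges. -/
abbrev Graph : Type := (⊤ : SimpleGraph ℕ+).Subgraph

/-- The graph with edge set `E` (parallel edges identified) and with the minimal vertex set,
that is, the set of all endpoints of edges in `E`. -/
def graphOf (E : Set Edge) : Graph where
  verts := {v | ∃ e ∈ E, v ∈ e.1}
  Adj i j := ∃ e ∈ E, e.1 = s(i, j)
  adj_sub := by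
    rintro i j ⟨e, -, he⟩
    have h := e.2
    rw [he] at h
    simpa using h
  edge_vert := by
    rintro i j ⟨e, he, h⟩
    exact ⟨e, he, by simp [h]⟩
  symm := ⟨by
    rintro i j ⟨e, he, h⟩
    exact ⟨e, he, by rw [h, Sym2.eq_swap]⟩⟩

/-- The graph `G_n` obtained from the sampled edges `x 0, x 1, x 2, …`: start with the empty graph
and successively take the union with the next edge (and its two endpoints). -/
def discreteGraph (x : ℕ → Edge) : ℕ → Graph
  | 0 => ⊥
  | n + 1 => discreteGraph x n ⊔ graphOf {x n}

/-- The graph `G_t` obtained from the counting functions `k e : ℝ≥0 → ℕ`: the edge `e` is present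
at time `t` iff its multiplicity `k e t` is positive. -/
def continuousGraph (k : Edge → ℝ≥0 → ℕ) (t : ℝ≥0) : Graph :=
  graphOf {e | 0 < k e t}

/-- A trajectory `x` satisfies the property `A` eventually forever. -/
def EventuallyForever {I S : Type*} [LT I] (x : I → S) (A : S → Prop) : Prop :=
  ∃ i, ∀ j, i < j → A (x j)

/-- `N` is a (homogeneous) Poisson process with intensity `r ≥ 0`. -/
structure IsPoissonProcess {Ω : Type*} [MeasurableSpace Ω] (P : Measure Ω) (r : ℝ≥0)
    (N : ℝ≥0 → Ω → ℕ) : Prop where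
  measurable : ∀ t, Measurable (N t)
  /-- Almost every path is a counting function. -/
  zero : ∀ᵐ ω ∂P, N 0 ω = 0
  mono : ∀ᵐ ω ∂P, Monotone fun t => N t ω
  rightCont : ∀ᵐ ω ∂P, ∀ t, ContinuousWithinAt (fun s => N s ω) (Set.Ici t) t
  indepIncrements : HasIndepIncrements N P
  increments : ∀ s t, s ≤ t →
    HasLaw (fun ω => N t ω - N s ω) (poissonMeasure (r * (t - s))) P

/-- `X 0, X 1, X 2, …` are i.i.d. edges with law `μ`. -/
structure IsEdgeSampling {Ω : Type*} [MeasurableSpace Ω] (P : Measure Ω) (μ : Measure Edge)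
    (X : ℕ → Ω → Edge) : Prop where
  law : ∀ n, HasLaw (X n) μ P
  indep : iIndepFun X P

/-- The `N e`, for `e` an edge, are independent Poisson processes, `N e` with intensity
`μ {e}`. -/
structure IsEdgePoissonization {Ω : Type*} [MeasurableSpace Ω] (P : Measure Ω) (μ : Measure Edge)
    (N : Edge → ℝ≥0 → Ω → ℕ) : Prop where
  poisson : ∀ e, IsPoissonProcess P (μ {e}).toNNReal (N e)
  /-- Independence of the whole processes (as random elements of `ℝ≥0 → ℕ`). -/
  indep : iIndepFun (fun e ω t => N e t ω) P

end EdgeGraph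

open Filter Topology

/-! Both processes are read as unions of independent random edge sets `Y 0, Y 1, …`: one sampled
edge per step in discrete time, the edges that ring during a unit time slot in continuous time.
`IsRandomEdgeSets` keeps only what the argument needs: independence over slots, P(e ∈ Y n) between
μ(e)/2 and μ(e), and a product bound for two distinct edges.

If γ > 2, the vertex 1 becomes a hub. An edge {i,j} with 1 < i < j occurs before {1,i} with
probability at most 2μ(ij)/μ(1i) = 2j^(-γ) (`prob_before_le`), and the sum of j^(-γ) over i < j
converges because γ > 2. By Borel–Cantelli only finitely many pairs misbehave; once their hub edges
have arrived, every edge present hangs on 1 (`connected_graphOf`).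

If γ ≤ 2, isolated edges keep appearing. Near b^(2/γ) ≥ b there are two blocks of b vertices, all
with weight v^(-γ) of order b^(-2). The edges between the blocks have total mass of order b^(-2),
and each vertex carries mass O(b^(-2)). So in a window of order b² steps exactly one such edge
occurs, unspoilt by its neighbours, with probability bounded below (`le_prob_hasIsolated`). One step
touches the blocks with probability only O(1/b), so a past much shorter than b has most likely left
them alone. Disjoint windows of rapidly growing length and the second Borel–Cantelli lemma then give
disconnection infinitely often (`ae_frequently_not_connected`). -/

/-- If the variables `X i j` are independent as a family indexed by pairs, then the families
`(X i j)_j` are independent. -/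
theorem ProbabilityTheory.iIndepFun.curry {Ω ι : Type*} {mΩ : MeasurableSpace Ω} {P : Measure Ω}
    {κ : ι → Type*} {S : (i : ι) → κ i → Type*} {mS : ∀ i j, MeasurableSpace (S i j)}
    {X : (i : ι) → (j : κ i) → Ω → S i j} (mX : ∀ i j, Measurable (X i j))
    (h : iIndepFun (fun (p : (i : ι) × κ i) ω => X p.1 p.2 ω) P) :
    iIndepFun (fun i ω j => X i j ω) P := by
  have := h.isProbabilityMeasure
  have : ∀ i j, IsProbabilityMeasure (P.map (X i j)) :=
    fun i j => Measure.isProbabilityMeasure_map (mX i j).aemeasurable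
  have hc : (fun ω i j => X i j ω) = (MeasurableEquiv.piCurry S) ∘ (fun ω p => X p.1 p.2 ω) := by
    ext; simp [Sigma.curry]
  have hi : ∀ i, iIndepFun (X i) P := fun i =>
    h.precomp (g := fun j => (⟨i, j⟩ : (i : ι) × κ i)) sigma_mk_injective
  rw [iIndepFun_iff_map_fun_eq_infinitePi_map (by fun_prop), hc,
    ← Measure.map_map (by fun_prop) (by fun_prop),
    (iIndepFun_iff_map_fun_eq_infinitePi_map (by fun_prop)).1 h,
    Measure.infinitePi_map_piCurry (fun i j => P.map (X i j))]
  congrm Measure.infinitePi fun i => ?_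
  rw [(iIndepFun_iff_map_fun_eq_infinitePi_map (by fun_prop)).1 (hi i)]

namespace EdgeGraph

/-! ### Reduction of both models to independent random edge sets -/

/-- Independent random sets of edges whose marginals are comparable with `μ`. -/
structure IsRandomEdgeSets {Ω ι : Type*} [MeasurableSpace Ω] (P : Measure Ω) (μ : Measure Edge)
    (Y : ι → Ω → Set Edge) : Prop where
  measurable : ∀ n, Measurable (Y n)
  indep : iIndepFun Y P
  prob_mem_le : ∀ n e, P {ω | e ∈ Y n ω} ≤ μ {e}
  le_prob_mem : ∀ n e, μ {e} ≤ 2 * P {ω | e ∈ Y n ω}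
  prob_mem_mem_le : ∀ n e f, e ≠ f → P {ω | e ∈ Y n ω ∧ f ∈ Y n ω} ≤ μ {e} * μ {f}

theorem IsRandomEdgeSets.precomp {Ω ι κ : Type*} [MeasurableSpace Ω] {P : Measure Ω}
    {μ : Measure Edge} {Y : ι → Ω → Set Edge} (h : IsRandomEdgeSets P μ Y) {g : κ → ι}
    (hg : g.Injective) : IsRandomEdgeSets P μ fun k => Y (g k) where
  measurable k := h.measurable (g k)
  indep := h.indep.precomp hg
  prob_mem_le k := h.prob_mem_le (g k)
  le_prob_mem k := h.le_prob_mem (g k)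
  prob_mem_mem_le k := h.prob_mem_mem_le (g k)

/-- The union of the first `n` random edge sets. -/
def accumulated (Y : ℕ → Set Edge) (n : ℕ) : Set Edge := {e | ∃ k < n, e ∈ Y k}

theorem graphOf_union (E F : Set Edge) : graphOf (E ∪ F) = graphOf E ⊔ graphOf F := by
  ext i j
  · simp [graphOf, or_and_right, exists_or]
  · simp [graphOf, or_and_right, exists_or]

theorem discreteGraph_eq (x : ℕ → Edge) (n : ℕ) :
    discreteGraph x n = graphOf (accumulated (fun k => {x k}) n) := by
  induction n with
  | zero =>
    ext i j <;> simp [graphOf, accumulated, discreteGraph]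
  | succ n ih =>
    rw [discreteGraph, ih, ← graphOf_union]
    congr 1
    ext e
    simp only [accumulated, Set.mem_union, Set.mem_ofPred_eq, Set.mem_singleton_iff,
      Nat.lt_succ_iff_lt_or_eq]
    grind

/-- `HasLaw` supplies only a.e. measurability, so the sets are built from measurable modifications
and agree with the samples almost surely. -/
theorem IsEdgeSampling.exists_randomEdgeSets {Ω : Type*} [MeasurableSpace Ω] {P : Measure Ω}
    {μ : Measure Edge} {X : ℕ → Ω → Edge} (h : IsEdgeSampling P μ X) :
    ∃ Y : ℕ → Ω → Set Edge, IsRandomEdgeSets P μ Y ∧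
      ∀ᵐ ω ∂P, ∀ n, discreteGraph (fun n => X n ω) n =
        graphOf (accumulated (fun k => Y k ω) n) := by
  have hX n := (h.law n).aemeasurable
  have hm : Measurable (fun e : Edge => ({e} : Set Edge)) := .of_discrete
  have hl n : HasLaw ((hX n).mk) μ P := (h.law n).congr (hX n).ae_eq_mk.symm
  have he n e : P {ω | e = (hX n).mk (X n) ω} = μ {e} := by
    rw [(hl n).measure_eq (p := fun x => e = x) .of_discrete]
    congr 1; ext; simp [eq_comm]
  refine ⟨fun n ω => {(hX n).mk (X n) ω}, ⟨fun n => hm.comp (hX n).measurable_mk, ?_,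
    fun n e => (he n e).le, fun n e => ?_, fun n e f hef => ?_⟩, ?_⟩
  · exact (h.indep.congr fun n => (hX n).ae_eq_mk).comp (fun _ e => {e}) fun _ => hm
  · simp only [Set.mem_singleton_iff, he, two_mul]
    exact le_self_add
  · have : {ω | e ∈ ({(hX n).mk (X n) ω} : Set Edge) ∧ f ∈ ({(hX n).mk (X n) ω} : Set Edge)}
        = ∅ := by
      ext ω; simp; grind
    rw [this]; simp
  · filter_upwards [ae_all_iff.2 fun n => (hX n).ae_eq_mk] with ω hω n
    rw [discreteGraph_eq]
    simp [hω]

theorem poissonMeasure_pos (r : ℝ≥0) :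
    poissonMeasure r {k | 0 < k} = ENNReal.ofReal (1 - Real.exp (-r)) := by
  have : {k : ℕ | 0 < k} = {0}ᶜ := by ext; simp [Nat.pos_iff_ne_zero]
  rw [this, prob_compl_eq_one_sub .of_discrete, poissonMeasure_singleton,
    ENNReal.ofReal_sub _ (by positivity)]
  simp

/-- Independence across edges and independence of increments in time combine into independence over
all pairs (edge, slot), which is then regrouped by slot. The marginals are 1 - exp(-μ(e)),
comparable with μ(e) because μ(e) ≤ 1. -/
theorem IsEdgePoissonization.randomEdgeSets {Ω : Type*} [MeasurableSpace Ω] {P : Measure Ω}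
    {μ : Measure Edge} [IsProbabilityMeasure μ] {N : Edge → ℝ≥0 → Ω → ℕ}
    (h : IsEdgePoissonization P μ N) :
    IsRandomEdgeSets P μ fun (n : ℕ) ω => {e | 0 < N e (n + 1) ω - N e n ω} := by
  have hN e n : Measurable fun ω => N e ((n : ℕ) + 1) ω - N e n ω :=
    ((h.poisson e).measurable _).sub ((h.poisson e).measurable _)
  have hset : Measurable fun (d : Edge → ℕ) => {e | 0 < d e} := by
    refine measurable_set_iff.2 fun e => ?_
    exact (Measurable.of_discrete (f := fun k : ℕ => 0 < k)).comp (measurable_pi_apply e)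
  have hproc : iIndepFun (fun e ω n => N e ((n : ℕ) + 1) ω - N e n ω) P :=
    h.indep.comp (fun _ p (n : ℕ) => p (n + 1) - p n) fun _ => by
      refine measurable_pi_lambda _ fun n => ?_
      exact (measurable_pi_apply _).sub (measurable_pi_apply _)
  have hinc e : iIndepFun (fun (n : ℕ) ω => N e (n + 1) ω - N e n ω) P := by
    have := (h.poisson e).indepIncrements.nat (t := fun n : ℕ => (n : ℝ≥0)) Nat.mono_cast
    simpa using this
  have hall := iIndepFun_uncurry' hN hproc hinc
  have hind : iIndepFun (fun (n : ℕ) ω e => N e (n + 1) ω - N e n ω) P :=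
    iIndepFun.curry (X := fun (n : ℕ) e ω => N e (n + 1) ω - N e n ω) (fun n e => hN e n)
      (hall.precomp (g := fun p : (_ : ℕ) × Edge => (p.2, p.1)) (by
        rintro ⟨a, b⟩ ⟨c, d⟩ h; simp at h; simp [h]))
  have hp n e : P {ω | 0 < N e ((n : ℕ) + 1) ω - N e n ω}
      = ENNReal.ofReal (1 - Real.exp (-(μ {e}).toReal)) := by
    rw [((h.poisson e).increments n (n + 1) (by simp)).measure_eq (p := fun k => 0 < k)
      .of_discrete, poissonMeasure_pos]
    simp [ENNReal.toReal]
  have hle n e : P {ω | 0 < N e ((n : ℕ) + 1) ω - N e n ω} ≤ μ {e} := by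
    rw [hp]
    refine ENNReal.ofReal_le_of_le_toReal ?_
    linarith [Real.add_one_le_exp (-(μ {e}).toReal)]
  refine ⟨fun n => hset.comp (measurable_pi_lambda _ fun e => hN e n),
    hind.comp (fun _ d => {e | 0 < d e}) fun _ => hset, hle, fun n e => ?_, fun n e f hef => ?_⟩
  · simp only [Set.mem_ofPred_eq]
    rw [hp]
    have h1 : (μ {e}).toReal ≤ 1 := measureReal_le_one
    have h0 : 0 ≤ (μ {e}).toReal := ENNReal.toReal_nonneg
    rw [← ENNReal.ofReal_toReal (measure_ne_top μ {e}), ENNReal.toReal_ofReal h0,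
      ← ENNReal.ofReal_ofNat 2, ← ENNReal.ofReal_mul (by norm_num)]
    refine ENNReal.ofReal_le_ofReal ?_
    set x := (μ {e}).toReal
    -- This yields 1 - exp(-x) ≥ x/(1+x) ≥ x/2, as 0 ≤ x ≤ 1.
    have h2 : Real.exp (-x) * (1 + x) ≤ 1 := by
      calc Real.exp (-x) * (1 + x) ≤ Real.exp (-x) * Real.exp x := by
            gcongr; linarith [Real.add_one_le_exp x]
        _ = 1 := by rw [← Real.exp_add]; simp
    nlinarith [Real.exp_pos (-x)]
  · have h2 := (hproc.indepFun hef).measure_inter_preimage_eq_mul {d | 0 < d n} {d | 0 < d n}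
      (measurableSet_lt measurable_const (measurable_pi_apply n))
      (measurableSet_lt measurable_const (measurable_pi_apply n))
    calc P {ω | 0 < N e ((n : ℕ) + 1) ω - N e n ω ∧ 0 < N f ((n : ℕ) + 1) ω - N f n ω}
        = _ := h2
      _ ≤ _ := mul_le_mul' (hle n e) (hle n f)

/-- The slots determine the graph at integer times only; monotonicity of the paths is kept so that
other times can be squeezed between consecutive integers. -/
theorem IsEdgePoissonization.ae_pos_iff {Ω : Type*} [MeasurableSpace Ω] {P : Measure Ω}
    {μ : Measure Edge} {N : Edge → ℝ≥0 → Ω → ℕ} (h : IsEdgePoissonization P μ N) :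
    ∀ᵐ ω ∂P, (∀ n : ℕ, {e | 0 < N e n ω} =
      accumulated (fun k => {e | 0 < N e (k + 1) ω - N e k ω}) n) ∧
      ∀ e, Monotone fun t => N e t ω := by
  filter_upwards [ae_all_iff.2 fun e => (h.poisson e).zero,
    ae_all_iff.2 fun e => (h.poisson e).mono] with ω h0 hm
  refine ⟨fun n => ?_, hm⟩
  ext e
  simp only [accumulated, Set.mem_ofPred_eq]
  induction n with
  | zero => simp [h0]
  | succ n ih =>
    have := hm e (show (n : ℝ≥0) ≤ n + 1 by simp)
    simp only [Nat.lt_succ_iff_lt_or_eq, or_and_right, exists_or, ← ih, exists_eq_left]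
    push_cast
    simp only at this
    omega

/-! ### Which of two edges occurs first -/

theorem measurableSet_mem (e : Edge) : MeasurableSet {S : Set Edge | e ∈ S} :=
  measurableSet_setOfPred.2 (measurable_set_mem e)

theorem measurableSet_notMem (e : Edge) : MeasurableSet {S : Set Edge | e ∉ S} :=
  measurableSet_setOfPred.2 (measurable_set_notMem e)

section

variable {Ω : Type*} [MeasurableSpace Ω] {P : Measure Ω} {μ : Measure Edge}
  {Y : ℕ → Ω → Set Edge}

theorem IsRandomEdgeSets.prob_notMem_le [IsProbabilityMeasure P] (h : IsRandomEdgeSets P μ Y)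
    (n : ℕ) (e : Edge) : P {ω | e ∉ Y n ω} ≤ 1 - μ {e} / 2 := by
  have : {ω | e ∉ Y n ω} = (Y n ⁻¹' {S | e ∈ S})ᶜ := rfl
  rw [this, prob_compl_eq_one_sub (h.measurable n (measurableSet_mem e))]
  gcongr
  exact ENNReal.div_le_of_le_mul' (h.le_prob_mem n e)

theorem IsRandomEdgeSets.prob_forall_notMem_le [IsProbabilityMeasure P]
    (h : IsRandomEdgeSets P μ Y) (n : ℕ) (e : Edge) :
    P {ω | ∀ k < n, e ∉ Y k ω} ≤ (1 - μ {e} / 2) ^ n := by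
  have := h.indep.measure_inter_preimage_eq_mul (Finset.range n) (sets := fun _ => {S | e ∉ S})
    fun _ _ => measurableSet_notMem e
  have h2 : {ω | ∀ k < n, e ∉ Y k ω} = ⋂ i ∈ Finset.range n, Y i ⁻¹' {S | e ∉ S} := by
    ext; simp
  rw [h2, this]
  calc _ ≤ ∏ i ∈ Finset.range n, (1 - μ {e} / 2) :=
        Finset.prod_le_prod' fun i _ => h.prob_notMem_le i e
    _ = _ := by simp

theorem IsRandomEdgeSets.ae_exists_mem [IsProbabilityMeasure P]
    (h : IsRandomEdgeSets P μ Y) (e : Edge) (he : μ {e} ≠ 0) :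
    ∀ᵐ ω ∂P, ∃ k, e ∈ Y k ω := by
  rw [ae_iff]
  have hlt : 1 - μ {e} / 2 < 1 := ENNReal.sub_lt_self (by simp) (by simp) (by simp [he])
  refine le_antisymm (ge_of_tendsto' (ENNReal.tendsto_pow_atTop_nhds_zero_of_lt_one hlt)
    fun n => ?_) bot_le
  refine (measure_mono ?_).trans (h.prob_forall_notMem_le n e)
  intro ω hω k _ hk
  exact hω ⟨k, hk⟩

/-- The edge `e` occurs at some time at which `f` has not yet occurred. -/
def before (Y : ℕ → Set Edge) (e f : Edge) : Prop := ∃ m, e ∈ Y m ∧ ∀ k < m, f ∉ Y k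

/-- Sum over the slot m in which e occurs: slots are independent, so the bound is a geometric series
of ratio 1 - μ(f)/2. -/
theorem IsRandomEdgeSets.prob_before_le [IsProbabilityMeasure P] [IsProbabilityMeasure μ]
    (h : IsRandomEdgeSets P μ Y) (e f : Edge) :
    P {ω | before (fun k => Y k ω) e f} ≤ μ {e} * (μ {f} / 2)⁻¹ := by
  have hm m : P {ω | e ∈ Y m ω ∧ ∀ k < m, f ∉ Y k ω} ≤ μ {e} * (1 - μ {f} / 2) ^ m := by
    have := h.indep.measure_inter_preimage_eq_mul (Finset.range (m + 1))
      (sets := fun k => if k = m then {S | e ∈ S} else {S | f ∉ S})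
      fun k _ => by
        split_ifs
        exacts [measurableSet_mem e, measurableSet_notMem f]
    have h2 : {ω | e ∈ Y m ω ∧ ∀ k < m, f ∉ Y k ω} = ⋂ i ∈ Finset.range (m + 1),
        Y i ⁻¹' (if i = m then {S | e ∈ S} else {S | f ∉ S}) := by
      ext ω
      simp only [Set.mem_ofPred_eq, Finset.mem_range, Set.mem_iInter, Set.mem_preimage]
      constructor
      · rintro ⟨h1, h2⟩ i hi
        split_ifs with him
        · exact him ▸ h1
        · exact h2 i (by omega)
      · intro h1
        refine ⟨by simpa using h1 m (by omega), fun k hk => ?_⟩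
        simpa [hk.ne] using h1 k (by omega)
    rw [h2, this, Finset.prod_range_succ, mul_comm]
    simp only [if_true]
    gcongr
    · exact h.prob_mem_le m e
    · calc _ ≤ ∏ i ∈ Finset.range m, (1 - μ {f} / 2) := by
            refine Finset.prod_le_prod' fun i hi => ?_
            rw [if_neg (Finset.mem_range.1 hi).ne]
            exact h.prob_notMem_le i f
        _ = _ := by simp
  calc P {ω | before (fun k => Y k ω) e f}
      = P (⋃ m, {ω | e ∈ Y m ω ∧ ∀ k < m, f ∉ Y k ω}) := by
        congr 1; ext; simp [before]
    _ ≤ ∑' m, P {ω | e ∈ Y m ω ∧ ∀ k < m, f ∉ Y k ω} := measure_iUnion_le _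
    _ ≤ ∑' m, μ {e} * (1 - μ {f} / 2) ^ m := ENNReal.tsum_le_tsum hm
    _ = _ := by
      rw [ENNReal.tsum_mul_left, ENNReal.tsum_geometric, ENNReal.sub_sub_cancel (by simp)]
      exact ENNReal.div_le_of_le_mul (prob_le_one.trans (by norm_num))

end

/-! ### Case γ > 2: the vertex 1 as a hub -/

theorem exists_edge_eq_mk (e : Edge) : ∃ (i j : ℕ+) (h : i < j), e = Edge.mk i j h.ne := by
  obtain ⟨e, he⟩ := e
  induction e with | _ i j
  have hij : i ≠ j := by simpa using he
  rcases lt_or_gt_of_ne hij with h | h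
  · exact ⟨i, j, h, rfl⟩
  · exact ⟨j, i, h, Subtype.ext Sym2.eq_swap⟩

/-- If the edges of `A` can be attached to the vertex `1`, then the graph is connected. -/
theorem connected_graphOf {A : Set Edge} (hne : A.Nonempty)
    (h : ∀ (i j : ℕ+) (h1 : 1 < i) (hij : i < j), Edge.mk i j hij.ne ∈ A →
      Edge.mk 1 i h1.ne ∈ A) : (graphOf A).Connected := by
  have hadj {i j : ℕ+} (hij : i ≠ j) (hA : Edge.mk i j hij ∈ A) : (graphOf A).Adj i j :=
    ⟨_, hA, rfl⟩
  have key : ∀ e ∈ A, ∃ (i j : ℕ+), e.1 = s(i, j) ∧ (i = 1 ∨ (graphOf A).Adj 1 i) ∧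
      (graphOf A).Adj i j := by
    intro e he
    obtain ⟨i, j, hij, rfl⟩ := exists_edge_eq_mk e
    refine ⟨i, j, rfl, ?_, hadj _ he⟩
    rcases eq_or_lt_of_le (one_le : 1 ≤ i) with h1 | h1
    · exact .inl h1.symm
    · exact .inr (hadj _ (h i j h1 hij he))
  have hone : 1 ∈ (graphOf A).verts := by
    obtain ⟨e, he⟩ := hne
    obtain ⟨i, j, -, rfl | h1, h2⟩ := key e he
    · exact h2.fst_mem
    · exact h1.fst_mem
  rw [SimpleGraph.Subgraph.connected_iff', SimpleGraph.connected_iff_exists_forall_reachable]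
  refine ⟨⟨1, hone⟩, fun ⟨v, e, he, hv⟩ => ?_⟩
  obtain ⟨i, j, hij, h1, h2⟩ := key e he
  have hi : (graphOf A).coe.Reachable ⟨1, hone⟩ ⟨i, h2.fst_mem⟩ := by
    rcases h1 with rfl | h1
    · rfl
    · exact SimpleGraph.Adj.reachable (by simpa using h1)
  rw [hij, Sym2.mem_iff] at hv
  rcases hv with rfl | rfl
  · exact hi
  · exact hi.trans (SimpleGraph.Adj.reachable (by simpa using h2))

/-- The measure `μ` gives the edge `{i, j}` the mass `c (ij)^{-γ}`. -/
def IsRankOne (μ : Measure Edge) (c γ : ℝ) : Prop :=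
  ∀ (i j : ℕ+) (h : i ≠ j), μ {Edge.mk i j h} = ENNReal.ofReal (c * ((i : ℝ) * (j : ℝ)) ^ (-γ))

theorem IsRankOne.pos {μ : Measure Edge} [IsProbabilityMeasure μ] {c γ : ℝ}
    (hμ : IsRankOne μ c γ) : 0 < c := by
  by_contra! hc
  have h0 : ∀ e : Edge, μ {e} = 0 := by
    intro e
    obtain ⟨i, j, hij, rfl⟩ := exists_edge_eq_mk e
    rw [hμ]
    exact ENNReal.ofReal_of_nonpos (mul_nonpos_of_nonpos_of_nonneg hc (by positivity))
  have : μ Set.univ = 0 := by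
    rw [← Set.biUnion_of_singleton Set.univ]
    exact (measure_biUnion_null_iff Set.countable_univ).2 fun e _ => h0 e
  simp at this

theorem IsRankOne.ne_zero {μ : Measure Edge} [IsProbabilityMeasure μ] {c γ : ℝ}
    (hμ : IsRankOne μ c γ) (i j : ℕ+) (h : i ≠ j) : μ {Edge.mk i j h} ≠ 0 := by
  have := hμ.pos
  have hi : (0 : ℝ) < i := by exact_mod_cast i.pos
  have hj : (0 : ℝ) < j := by exact_mod_cast j.pos
  rw [hμ]
  simp only [ne_eq, ENNReal.ofReal_eq_zero, not_le]
  positivity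

theorem summable_pnat_rpow {p : ℝ} : Summable (fun n : ℕ+ => (n : ℝ) ^ p) ↔ p < -1 := by
  rw [← Real.summable_nat_rpow]
  rw [summable_pnat_iff_summable_succ (f := fun n : ℕ => (n : ℝ) ^ p)]
  exact summable_nat_add_iff (f := fun n : ℕ => (n : ℝ) ^ p) 1

section

variable {Ω : Type*} [MeasurableSpace Ω] {P : Measure Ω} {μ : Measure Edge}
  {Y : ℕ → Ω → Set Edge}

/-- First Borel–Cantelli lemma. The bound 2j^(-γ) is at most 2i^(-γ/2)j^(-γ/2) for i < j, a product
of two series that converge since γ/2 > 1. -/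
theorem IsRandomEdgeSets.ae_finite_before [IsProbabilityMeasure P] [IsProbabilityMeasure μ]
    (h : IsRandomEdgeSets P μ Y) {c γ : ℝ} (hμ : IsRankOne μ c γ) (hγ : 2 < γ) :
    ∀ᵐ ω ∂P, {p : ℕ+ × ℕ+ | ∃ (h1 : 1 < p.1) (hij : p.1 < p.2),
      before (fun k => Y k ω) (Edge.mk p.1 p.2 hij.ne) (Edge.mk 1 p.1 h1.ne)}.Finite := by
  have hc := hμ.pos
  refine ae_finite_setOfPred_mem (s := fun p : ℕ+ × ℕ+ => {ω | ∃ (h1 : 1 < p.1) (hij : p.1 < p.2),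
      before (fun k => Y k ω) (Edge.mk p.1 p.2 hij.ne) (Edge.mk 1 p.1 h1.ne)}) ?_
  have hs : Summable fun p : ℕ+ × ℕ+ => 2 * ((p.1 : ℝ) ^ (-(γ / 2)) * (p.2 : ℝ) ^ (-(γ / 2))) := by
    have := (summable_pnat_rpow (p := -(γ / 2))).2 (by linarith)
    exact (this.mul_of_nonneg this (fun _ => by positivity) (fun _ => by positivity)).mul_left 2
  refine ne_top_of_le_ne_top hs.tsum_ofReal_ne_top (ENNReal.tsum_le_tsum fun ⟨i, j⟩ => ?_)
  by_cases hij : 1 < i ∧ i < j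
  · obtain ⟨h1, hij⟩ := hij
    simp only [h1, hij, exists_true_left]
    refine (h.prob_before_le _ _).trans ?_
    have hi : (0 : ℝ) < i := by exact_mod_cast i.pos
    have hj : (0 : ℝ) < j := by exact_mod_cast j.pos
    have hle : (i : ℝ) ≤ j := by exact_mod_cast hij.le
    rw [hμ, hμ, ← ENNReal.ofReal_ofNat 2, ← ENNReal.ofReal_div_of_pos (by norm_num),
      ← ENNReal.ofReal_inv_of_pos (by simp only [PNat.one_coe]; positivity),
      ← ENNReal.ofReal_mul (by positivity)]
    refine ENNReal.ofReal_le_ofReal ?_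
    calc c * ((i : ℝ) * j) ^ (-γ) * (c * (((1 : ℕ+) : ℝ) * i) ^ (-γ) / 2)⁻¹
        = 2 * (j : ℝ) ^ (-γ) := by
          rw [Real.mul_rpow hi.le hj.le]
          simp only [PNat.one_coe, Nat.cast_one, one_mul]
          have : (i : ℝ) ^ (-γ) ≠ 0 := by positivity
          field_simp
      _ = 2 * ((j : ℝ) ^ (-(γ / 2)) * (j : ℝ) ^ (-(γ / 2))) := by
          rw [← Real.rpow_add hj]; congr 2; ring
      _ ≤ _ := by
          gcongr 2 * (?_ * _)
          exact Real.rpow_le_rpow_of_nonpos hi hle (by linarith)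
  · have : {ω | ∃ (h1 : 1 < i) (hij : i < j),
      before (fun k => Y k ω) (Edge.mk i j hij.ne) (Edge.mk 1 i h1.ne)} = ∅ := by
      ext; simp; grind
    rw [this]; simp

theorem accumulated_mono (Y : ℕ → Set Edge) : Monotone (accumulated Y) :=
  fun _ _ hmn _ ⟨k, hk, he⟩ => ⟨k, hk.trans_le hmn, he⟩

/-- If `2 < γ`, then eventually all graphs between two consecutive accumulated edge sets are
connected. -/
theorem IsRandomEdgeSets.ae_eventually_connected [IsProbabilityMeasure P] [IsProbabilityMeasure μ]
    (h : IsRandomEdgeSets P μ Y) {c γ : ℝ} (hμ : IsRankOne μ c γ) (hγ : 2 < γ) :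
    ∀ᵐ ω ∂P, ∃ n₀, ∀ n ≥ n₀, ∀ A : Set Edge, accumulated (fun k => Y k ω) n ⊆ A →
      A ⊆ accumulated (fun k => Y k ω) (n + 1) → (graphOf A).Connected := by
  filter_upwards [h.ae_finite_before hμ hγ, ae_all_iff.2 fun i : {i : ℕ+ // 1 < i} =>
    h.ae_exists_mem (Edge.mk 1 i i.2.ne) (hμ.ne_zero _ _ _)] with ω hfin hex
  have hev : ∀ i : {i : ℕ+ // 1 < i}, ∀ᶠ n in atTop,
      Edge.mk 1 i i.2.ne ∈ accumulated (fun k => Y k ω) n := by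
    intro i
    obtain ⟨k, hk⟩ := hex i
    filter_upwards [eventually_gt_atTop k] with n hn
    exact ⟨k, hn, hk⟩
  have hev2 := (hfin.eventually_all (l := atTop)
    (p := fun p n => ∀ h1 : 1 < p.1, Edge.mk 1 p.1 h1.ne ∈ accumulated (fun k => Y k ω) n)).2
    fun p ⟨h1, _⟩ => (hev ⟨p.1, h1⟩).mono fun n hn _ => hn
  obtain ⟨n₀, hn₀⟩ := eventually_atTop.1 (hev2.and (hev ⟨2, by decide⟩))
  refine ⟨n₀, fun n hn A hA1 hA2 => connected_graphOf ⟨_, hA1 (hn₀ n hn).2⟩ ?_⟩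
  intro i j h1 hij he
  by_cases hb : before (fun k => Y k ω) (Edge.mk i j hij.ne) (Edge.mk 1 i h1.ne)
  · exact hA1 ((hn₀ n hn).1 (i, j) ⟨h1, hij, hb⟩ h1)
  -- The hub edge occurs in a slot strictly before m ≤ n, so it already lies in the n-th accumulated
  -- set, even when A contains only part of slot n.
  · obtain ⟨m, hm, hem⟩ := hA2 he
    simp only [before, not_exists, not_and, not_forall, not_not] at hb
    obtain ⟨k, hk, hek⟩ := hb m hem
    exact hA1 ⟨k, by omega, hek⟩

end

/-! ### Isolated edges within one time window -/

/-- The edges `e` and `f` have a common endpoint. -/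
def Touches (e f : Edge) : Prop := ∃ v, v ∈ e.1 ∧ v ∈ f.1

/-- A graph with two edges, one of which is isolated, is not connected. -/
theorem not_connected_graphOf {A : Set Edge} {e f : Edge} (he : e ∈ A) (hf : f ∈ A)
    (hef : ¬ Touches e f) (hiso : ∀ g ∈ A, Touches e g → g = e) : ¬ (graphOf A).Connected := by
  have hmem (g : Edge) : ∃ v, v ∈ g.1 := by
    obtain ⟨i, j, h, rfl⟩ := exists_edge_eq_mk g
    exact ⟨i, Sym2.mem_mk_left i j⟩
  obtain ⟨u, hu⟩ := hmem e
  obtain ⟨v, hv⟩ := hmem f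
  intro hc
  rw [SimpleGraph.Subgraph.connected_iff'] at hc
  obtain ⟨p⟩ := hc.preconnected ⟨u, e, he, hu⟩ ⟨v, f, hf, hv⟩
  have key : ∀ {x y : (graphOf A).verts}, (graphOf A).coe.Walk x y → x.1 ∈ e.1 → y.1 ∈ e.1 := by
    intro x y p
    induction p with
    | nil => exact id
    | cons hadj _ ih =>
      intro hx
      refine ih ?_
      obtain ⟨g, hg, hgs⟩ := hadj
      rw [← hiso g hg ⟨_, hx, by rw [hgs]; exact Sym2.mem_mk_left _ _⟩, hgs]
      exact Sym2.mem_mk_right _ _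
  exact hef ⟨v, key p hu, hv⟩

/-- The edges that must be absent for an edge `e` of `W` to be isolated and the only edge
in `W`, together with `e` itself. -/
def rivals (W : Finset Edge) (e : Edge) : Set Edge := {f | f ∈ W ∨ Touches e f}

/-- The edge `e` occurs in `y k`, and no rival occurs anywhere else. -/
def IsolatedAt {κ : Type*} (W : Finset Edge) (y : κ → Set Edge) (k : κ) (e : Edge) : Prop :=
  e ∈ y k ∧ ∀ k', ∀ f ∈ rivals W e, f ∈ y k' → k' = k ∧ f = e

theorem measurable_isolatedAt {κ : Type*} [Countable κ] (W : Finset Edge) (k : κ) (e : Edge) :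
    Measurable fun y : κ → Set Edge => IsolatedAt W y k e := by
  have hm k' f : Measurable fun y : κ → Set Edge => f ∈ y k' :=
    (measurable_set_mem f).comp (measurable_pi_apply k')
  refine (hm k e).and (Measurable.forall fun k' => Measurable.forall fun f => ?_)
  exact measurable_const.imp ((hm k' f).imp measurable_const)

/-- Some edge of `W` is isolated. -/
def HasIsolated {κ : Type*} (W : Finset Edge) (y : κ → Set Edge) : Prop :=
  ∃ k, ∃ e ∈ W, IsolatedAt W y k e

theorem measurable_hasIsolated {κ : Type*} [Countable κ] (W : Finset Edge) :
    Measurable fun y : κ → Set Edge => HasIsolated W y :=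
  Measurable.exists fun k => Measurable.exists fun e =>
    measurable_const.and (measurable_isolatedAt W k e)

section

variable {Ω ι : Type*} [MeasurableSpace Ω] {P : Measure Ω} {μ : Measure Edge}
  {Y : ι → Ω → Set Edge}

theorem measure_eq_tsum_singleton (μ : Measure Edge) (F : Set Edge) :
    ∑' e : F, μ {e.1} = μ F := by
  rw [← measure_biUnion F.to_countable (fun a _ b _ hab => by simpa using hab)
    fun _ _ => .of_discrete]
  simp

theorem IsRandomEdgeSets.prob_exists_mem_le (h : IsRandomEdgeSets P μ Y) (n : ι)
    (F : Set Edge) : P {ω | ∃ f ∈ F, f ∈ Y n ω} ≤ μ F := by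
  have : {ω | ∃ f ∈ F, f ∈ Y n ω} = ⋃ f ∈ F, {ω | f ∈ Y n ω} := by ext; simp
  rw [this, ← measure_eq_tsum_singleton]
  exact (measure_biUnion_le P F.to_countable _).trans
    (ENNReal.tsum_le_tsum fun f => h.prob_mem_le n f)

theorem IsRandomEdgeSets.prob_mem_exists_mem_le (h : IsRandomEdgeSets P μ Y) (n : ι)
    (e : Edge) (F : Set Edge) (he : e ∉ F) :
    P {ω | e ∈ Y n ω ∧ ∃ f ∈ F, f ∈ Y n ω} ≤ μ {e} * μ F := by
  have : {ω | e ∈ Y n ω ∧ ∃ f ∈ F, f ∈ Y n ω} = ⋃ f ∈ F, {ω | e ∈ Y n ω ∧ f ∈ Y n ω} := by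
    ext; simp
  rw [this, ← measure_eq_tsum_singleton μ F, ← ENNReal.tsum_mul_left]
  exact (measure_biUnion_le P F.to_countable _).trans
    (ENNReal.tsum_le_tsum fun f => h.prob_mem_mem_le n e f (by rintro rfl; exact he f.2))

theorem measurableSet_forall_notMem (F : Set Edge) :
    MeasurableSet {S : Set Edge | ∀ f ∈ F, f ∉ S} :=
  measurableSet_setOfPred.2 <| Measurable.forall fun f =>
    measurable_const.imp (measurable_set_notMem f)

variable [IsProbabilityMeasure P] [IsProbabilityMeasure μ]

theorem IsRandomEdgeSets.le_prob_forall_notMem (h : IsRandomEdgeSets P μ Y) (n : ι)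
    (F : Set Edge) : 1 - μ.real F ≤ P.real {ω | ∀ f ∈ F, f ∉ Y n ω} := by
  have h1 : {ω | ∀ f ∈ F, f ∉ Y n ω} = {ω | ∃ f ∈ F, f ∈ Y n ω}ᶜ := by ext; simp
  have h2 : MeasurableSet {ω | ∀ f ∈ F, f ∉ Y n ω} :=
    h.measurable n (measurableSet_forall_notMem F)
  have h3 : P.real {ω | ∃ f ∈ F, f ∈ Y n ω} ≤ μ.real F :=
    ENNReal.toReal_mono (by finiteness) (h.prob_exists_mem_le n F)
  have h4 := probReal_compl_eq_one_sub (μ := P) h2.compl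
  rw [compl_compl, h1, compl_compl] at h4
  rw [h1, h4]
  linarith

/-- From P(e ∈ Y n) ≥ μ(e)/2 subtract the chance of a simultaneous edge of F, at most μ(e)μ(F) ≤
μ(e)/4. -/
theorem IsRandomEdgeSets.le_prob_mem_forall_notMem (h : IsRandomEdgeSets P μ Y) (n : ι)
    (e : Edge) (F : Set Edge) (he : e ∉ F) (hF : μ.real F ≤ 1 / 4) :
    μ.real {e} / 4 ≤ P.real {ω | e ∈ Y n ω ∧ ∀ f ∈ F, f ∉ Y n ω} := by
  have h1 : μ.real {e} ≤ 2 * P.real {ω | e ∈ Y n ω} := by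
    simpa [measureReal_def] using ENNReal.toReal_mono (by finiteness) (h.le_prob_mem n e)
  have h2 : P.real {ω | e ∈ Y n ω ∧ ∃ f ∈ F, f ∈ Y n ω} ≤ μ.real {e} * μ.real F := by
    simpa [measureReal_def] using
      ENNReal.toReal_mono (by finiteness) (h.prob_mem_exists_mem_le n e F he)
  have h3 : P.real {ω | e ∈ Y n ω} ≤ P.real {ω | e ∈ Y n ω ∧ ∀ f ∈ F, f ∉ Y n ω}
      + P.real {ω | e ∈ Y n ω ∧ ∃ f ∈ F, f ∈ Y n ω} := by
    refine (measureReal_mono ?_ (by finiteness)).trans (measureReal_union_le _ _)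
    intro ω (hω : e ∈ Y n ω)
    by_cases hf : ∃ f ∈ F, f ∈ Y n ω
    · exact .inr ⟨hω, hf⟩
    · exact .inl ⟨hω, fun f hf1 hf2 => hf ⟨f, hf1, hf2⟩⟩
  nlinarith [measureReal_nonneg (μ := μ) (s := {e})]

/-- By independence the probability is a product over slots: slot k contributes at least μ(e)/4, the
others at least 1 - x each, and Bernoulli's inequality keeps their product above 1/2. -/
theorem IsRandomEdgeSets.le_prob_isolatedAt [Fintype ι] (h : IsRandomEdgeSets P μ Y)
    (W : Finset Edge) (k : ι) (e : Edge) {x : ℝ} (hx : μ.real (rivals W e) ≤ x)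
    (hx4 : x ≤ 1 / 4) (hcard : Fintype.card ι * x ≤ 1 / 2) :
    μ.real {e} / 8 ≤ P.real {ω | IsolatedAt W (fun k => Y k ω) k e} := by
  classical
  set A : Set (Set Edge) := {S | e ∈ S ∧ ∀ f ∈ rivals W e \ {e}, f ∉ S}
  set B : Set (Set Edge) := {S | ∀ f ∈ rivals W e, f ∉ S}
  have hA : MeasurableSet A :=
    (measurableSet_mem e).inter (measurableSet_forall_notMem _)
  have hB : MeasurableSet B := measurableSet_forall_notMem _
  have h1 : {ω | IsolatedAt W (fun k => Y k ω) k e} =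
      ⋂ i ∈ Finset.univ, Y i ⁻¹' (if i = k then A else B) := by
    ext ω
    simp only [Finset.mem_univ, Set.iInter_true, Set.mem_iInter, Set.mem_preimage,
      Set.mem_ofPred_eq]
    constructor
    · rintro ⟨h1, h2⟩ i
      split_ifs with hi
      · subst hi
        exact ⟨h1, fun f hf hfY => hf.2 (h2 i f hf.1 hfY).2⟩
      · exact fun f hf hfY => hi (h2 i f hf hfY).1
    · intro h1
      have hk : Y k ω ∈ A := by simpa using h1 k
      refine ⟨hk.1, fun i f hf hfY => ?_⟩
      by_cases hi : i = k
      · subst hi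
        exact ⟨rfl, by_contra fun hfe => hk.2 f ⟨hf, hfe⟩ hfY⟩
      · have := h1 i
        rw [if_neg hi] at this
        exact absurd hfY (this f hf)
  have h2 : P.real {ω | IsolatedAt W (fun k => Y k ω) k e} =
      ∏ i, P.real (Y i ⁻¹' (if i = k then A else B)) := by
    rw [h1, measureReal_def, h.indep.measure_inter_preimage_eq_mul Finset.univ
      fun i _ => by split_ifs <;> assumption, ENNReal.toReal_prod]
    rfl
  have hx0 : 0 ≤ x := measureReal_nonneg.trans hx
  have hkA : μ.real {e} / 4 ≤ P.real (Y k ⁻¹' A) :=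
    h.le_prob_mem_forall_notMem k e _ (by simp)
      ((measureReal_mono Set.sdiff_subset).trans (hx.trans hx4))
  have hpow : 1 / 2 ≤ (1 - x) ^ (Finset.univ.erase k).card := by
    have hle : (Finset.univ.erase k).card ≤ Fintype.card ι := Finset.card_le_univ _
    have hb := one_add_mul_le_pow (a := -x) (by linarith) (Fintype.card ι)
    calc (1 : ℝ) / 2 ≤ 1 + Fintype.card ι * -x := by linarith
      _ ≤ (1 + -x) ^ Fintype.card ι := hb
      _ = (1 - x) ^ Fintype.card ι := by rw [sub_eq_add_neg]
      _ ≤ _ := pow_le_pow_of_le_one (by linarith) (by linarith) hle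
  have hprod : (1 - x) ^ (Finset.univ.erase k).card ≤
      ∏ i ∈ Finset.univ.erase k, P.real (Y i ⁻¹' (if i = k then A else B)) := by
    rw [← Finset.prod_const]
    refine Finset.prod_le_prod (fun _ _ => by linarith) fun i hi => ?_
    rw [if_neg (Finset.ne_of_mem_erase hi)]
    exact (by linarith : 1 - x ≤ 1 - μ.real (rivals W e)).trans (h.le_prob_forall_notMem i _)
  rw [h2, ← Finset.mul_prod_erase _ _ (Finset.mem_univ k), if_pos rfl]
  calc μ.real {e} / 8 = μ.real {e} / 4 * (1 / 2) := by ring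
    _ ≤ _ := mul_le_mul hkA (hpow.trans hprod) (by norm_num) measureReal_nonneg

/-- All of W counts as rivals, so the events for different pairs (k, e) are disjoint and their
probabilities add up without inclusion–exclusion. -/
theorem IsRandomEdgeSets.le_prob_hasIsolated [Fintype ι] (h : IsRandomEdgeSets P μ Y)
    (W : Finset Edge) {x : ℝ} (hx : ∀ e ∈ W, μ.real (rivals W e) ≤ x)
    (hx4 : x ≤ 1 / 4) (hcard : Fintype.card ι * x ≤ 1 / 2) :
    Fintype.card ι * μ.real W / 8 ≤ P.real {ω | HasIsolated W (fun k => Y k ω)} := by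
  have hY : Measurable fun ω k => Y k ω := measurable_pi_lambda _ h.measurable
  have h1 : {ω | HasIsolated W (fun k => Y k ω)} =
      ⋃ p ∈ (Finset.univ : Finset ι) ×ˢ W, {ω | IsolatedAt W (fun k => Y k ω) p.1 p.2} := by
    ext ω
    simp [HasIsolated]
  rw [h1, measureReal_biUnion_finset]
  · calc Fintype.card ι * μ.real W / 8
        = ∑ p ∈ (Finset.univ : Finset ι) ×ˢ W, μ.real {p.2} / 8 := by
          rw [Finset.sum_product, ← sum_measureReal_singleton, mul_div_assoc, Finset.sum_div]
          simp
      _ ≤ _ := Finset.sum_le_sum fun p hp =>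
          h.le_prob_isolatedAt W p.1 p.2 (hx p.2 (Finset.mem_product.1 hp).2) hx4 hcard
  · rintro ⟨k, e⟩ hp ⟨k', e'⟩ hp' hne
    refine Set.disjoint_left.2 fun ω h1 h2 => hne ?_
    have := h1.2 k' e' (.inl (by simpa using hp')) h2.1
    simp [this]
  · exact fun p _ => hY (measurableSet_setOfPred.2 (measurable_isolatedAt W p.1 p.2))

end

/-! ### Disjoint time windows and the second Borel–Cantelli lemma -/

/-- The starting times of the time windows; the `m`-th window has length
`(2 ^ m * windowStart m) ^ 2`. -/
def windowStart : ℕ → ℕ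
  | 0 => 1
  | m + 1 => windowStart m + (2 ^ m * windowStart m) ^ 2

theorem windowStart_succ (m : ℕ) :
    windowStart (m + 1) = windowStart m + (2 ^ m * windowStart m) ^ 2 := rfl

theorem windowStart_pos (m : ℕ) : 0 < windowStart m := by
  induction m with
  | zero => exact Nat.one_pos
  | succ m ih => rw [windowStart_succ]; positivity

theorem windowStart_strictMono : StrictMono windowStart :=
  strictMono_nat_of_lt_succ fun m => by
    have := windowStart_pos m
    rw [windowStart_succ]
    exact Nat.lt_add_of_pos_right (by positivity)

theorem window_injective : Function.Injective
    fun p : (m : ℕ) × Fin ((2 ^ m * windowStart m) ^ 2) => windowStart p.1 + p.2 := by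
  have key : ∀ p q : (m : ℕ) × Fin ((2 ^ m * windowStart m) ^ 2), p.1 < q.1 →
      windowStart p.1 + p.2 < windowStart q.1 + q.2 := by
    intro p q hpq
    calc windowStart p.1 + p.2 < windowStart (p.1 + 1) := by
          rw [windowStart_succ]; exact Nat.add_lt_add_left p.2.2 _
      _ ≤ windowStart q.1 := windowStart_strictMono.monotone hpq
      _ ≤ _ := Nat.le_add_right _ _
  rintro ⟨m, k⟩ ⟨m', k'⟩ h
  rcases lt_trichotomy m m' with hlt | rfl | hlt
  · exact absurd h (key ⟨m, k⟩ ⟨m', k'⟩ hlt).ne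
  · have : k = k' := Fin.ext (by simpa using h)
    rw [this]
  · exact absurd h (key ⟨m', k'⟩ ⟨m, k⟩ hlt).ne'

section

variable {Ω : Type*} [MeasurableSpace Ω] {P : Measure Ω} {μ : Measure Edge}
  {Y : ℕ → Ω → Set Edge}

theorem IsRandomEdgeSets.prob_exists_mem_accumulated_le (h : IsRandomEdgeSets P μ Y) (n : ℕ)
    (F : Set Edge) :
    P {ω | ∃ f ∈ F, f ∈ accumulated (fun k => Y k ω) n} ≤ n * μ F := by
  have : {ω | ∃ f ∈ F, f ∈ accumulated (fun k => Y k ω) n} ⊆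
      ⋃ k ∈ Finset.range n, {ω | ∃ f ∈ F, f ∈ Y k ω} := by
    rintro ω ⟨f, hf, k, hk, hfk⟩
    simp only [Set.mem_iUnion]
    exact ⟨k, Finset.mem_range.2 hk, f, hf, hfk⟩
  calc _ ≤ _ := measure_mono this
    _ ≤ ∑ k ∈ Finset.range n, P {ω | ∃ f ∈ F, f ∈ Y k ω} := measure_biUnion_finset_le _ _
    _ ≤ ∑ k ∈ Finset.range n, μ F := Finset.sum_le_sum fun k _ => h.prob_exists_mem_le k F
    _ = _ := by simp

/-- If there are finite sets `W d` of edges such that, in `d ^ 2` steps, an isolated edge in `W d`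
appears with probability bounded below, while `W d` is touched in one step with probability
`O(1 / d)`, then isolated edges appear infinitely often. -/
theorem IsRandomEdgeSets.ae_frequently_not_connected [IsProbabilityMeasure P]
    [IsProbabilityMeasure μ]
    (h : IsRandomEdgeSets P μ Y) (W : ℕ → Finset Edge) {δ R : ℝ} (hδ : 0 < δ)
    (hrivals : ∀ d, 0 < d → ∀ e ∈ W d, μ.real (rivals (W d) e) ≤ 1 / (4 * (d : ℝ) ^ 2))
    (hmass : ∀ d : ℕ, 0 < d → δ ≤ (d : ℝ) ^ 2 * μ.real (W d))
    (htouch : ∀ d, 0 < d → μ.real {f | ∃ e ∈ W d, Touches e f} ≤ R / d)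
    (hne : ∃ f, μ {f} ≠ 0) :
    ∀ᵐ ω ∂P, ∃ᶠ n in atTop, ¬ (graphOf (accumulated (fun k => Y k ω) n)).Connected := by
  set d : ℕ → ℕ := fun m => 2 ^ m * windowStart m with hd
  have hd0 m : 0 < d m := by have := windowStart_pos m; positivity
  have hinj := window_injective
  set B : ℕ → Set Ω := fun m =>
    {ω | HasIsolated (W (d m)) (fun k : Fin (d m ^ 2) => Y (windowStart m + k) ω)} with hB
  have hcurry : iIndepFun (fun m ω (k : Fin (d m ^ 2)) => Y (windowStart m + k) ω) P :=
    iIndepFun.curry (X := fun m (k : Fin (d m ^ 2)) => Y (windowStart m + k))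
      (fun m k => h.measurable _) (h.indep.precomp hinj)
  have hBset m : MeasurableSet {y : Fin (d m ^ 2) → Set Edge | HasIsolated (W (d m)) y} :=
    measurableSet_setOfPred.2 (measurable_hasIsolated _)
  have hBm m : MeasurableSet (B m) :=
    (measurable_pi_lambda _ fun k : Fin (d m ^ 2) => h.measurable (windowStart m + k)) (hBset m)
  have hBindep : iIndepSet B P := (iIndepSet_iff_meas_biInter hBm).2 fun s =>
    hcurry.measure_inter_preimage_eq_mul s fun m _ => hBset m
  have hBprob m : ENNReal.ofReal (δ / 8) ≤ P (B m) := by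
    have hsub := h.precomp (g := fun k : Fin (d m ^ 2) => windowStart m + k)
      fun k k' hk => Fin.ext (by simpa using hk)
    have h1 : (1 : ℝ) ≤ (d m : ℝ) ^ 2 := one_le_pow₀ (by exact_mod_cast hd0 m)
    have h2 := hsub.le_prob_hasIsolated (W (d m)) (hrivals _ (hd0 m))
      (one_div_le_one_div_of_le (by norm_num) (by linarith)) (by
        rw [Fintype.card_fin]
        push_cast
        rw [mul_one_div, div_le_div_iff₀ (by positivity) (by norm_num)]
        linarith)
    rw [Fintype.card_fin] at h2
    push_cast at h2
    refine ENNReal.ofReal_le_of_le_toReal (le_trans ?_ h2)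
    have := hmass _ (hd0 m)
    linarith
  -- Second Borel–Cantelli lemma: the windows use disjoint sets of slots, and each event has
  -- probability at least δ/8.
  have hBio : ∀ᵐ ω ∂P, ∃ᶠ m in atTop, ω ∈ B m := by
    have h1 : P (limsup B atTop) = 1 := measure_limsup_eq_one hBm hBindep <| by
      refine top_unique (le_trans (le_of_eq ?_) (ENNReal.tsum_le_tsum hBprob))
      exact (ENNReal.tsum_const_eq_top_of_ne_zero (by simpa using hδ)).symm
    have h2 := (mem_ae_iff_prob_eq_one (.measurableSet_limsup hBm)).2 h1
    filter_upwards [h2] with ω hω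
    exact mem_limsup_iff_frequently_mem.1 hω
  -- First Borel–Cantelli lemma: the slots before window m touch `W (d m)` with probability at most
  -- `windowStart m * R / d m` = R/2^m. The factor 2^m in `d` is there to make this summable.
  have hCio : ∀ᵐ ω ∂P, ∀ᶠ m in atTop, ω ∉ {ω | ∃ f ∈ {f | ∃ e ∈ W (d m), Touches e f},
      f ∈ accumulated (fun k => Y k ω) (windowStart m)} := by
    refine ae_eventually_notMem ?_
    have hs : Summable fun m : ℕ => R * (1 / 2 : ℝ) ^ m := summable_geometric_two.mul_left R
    refine ne_top_of_le_ne_top hs.tsum_ofReal_ne_top (ENNReal.tsum_le_tsum fun m => ?_)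
    refine (h.prob_exists_mem_accumulated_le _ _).trans ?_
    have hw : (0 : ℝ) < windowStart m := by exact_mod_cast windowStart_pos m
    rw [← ENNReal.ofReal_natCast, ← ofReal_measureReal, ← ENNReal.ofReal_mul (by positivity)]
    refine ENNReal.ofReal_le_ofReal ?_
    calc _ ≤ (windowStart m : ℝ) * (R / d m) := by gcongr; exact htouch _ (hd0 m)
      _ = _ := by
        simp only [hd]
        push_cast
        rw [one_div, inv_pow]
        field_simp
  -- An edge f of positive mass eventually occurs and serves as the second component: being in the
  -- past of a late window, it does not touch the isolated edge.
  obtain ⟨f, hf⟩ := hne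
  filter_upwards [hBio, hCio, h.ae_exists_mem f hf] with ω hBω hCω ⟨k, hk⟩
  rw [frequently_atTop]
  intro n₀
  obtain ⟨m, hm, hC, hn, hkm⟩ := (hBω.and_eventually (hCω.and
    ((eventually_ge_atTop n₀).and (eventually_gt_atTop k)))).exists
  refine ⟨windowStart (m + 1),
    hn.trans ((Nat.le_succ m).trans windowStart_strictMono.le_apply), ?_⟩
  obtain ⟨l, e, heW, hel, hiso⟩ := hm
  have hsm := windowStart_succ m
  refine not_connected_graphOf (e := e) (f := f)
    ⟨windowStart m + l, by rw [hsm]; exact Nat.add_lt_add_left l.2 _, hel⟩ ⟨k, ?_, hk⟩ ?_ ?_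
  · exact hkm.trans_le ((Nat.le_succ m).trans windowStart_strictMono.le_apply)
  · exact fun hef => hC ⟨f, ⟨e, heW, hef⟩, k, hkm.trans_le windowStart_strictMono.le_apply, hk⟩
  · rintro g ⟨j, hj, hgj⟩ hge
    -- A neighbour of e would come either from the past, excluded by `hC`, or from the window, where
    -- it is a rival.
    by_cases hjm : j < windowStart m
    · exact absurd ⟨g, ⟨e, heW, hge⟩, j, hjm, hgj⟩ hC
    · refine (hiso ⟨j - windowStart m, ?_⟩ g (.inr hge) ?_).2
      · change _ < (2 ^ m * windowStart m) ^ 2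
        omega
      · simpa [Nat.add_sub_cancel' (not_lt.1 hjm)] using hgj

end

/-! ### Mass estimates for the rank-one measure and the vertex blocks -/

section

variable {μ : Measure Edge} {c γ : ℝ}

/-- The edge `{i, j}` as a set, empty if `i = j`. -/
def edgeSet (i j : ℕ+) : Set Edge := {e | ∃ h : i ≠ j, e = Edge.mk i j h}

theorem edgeSet_of_ne {i j : ℕ+} (h : i ≠ j) : edgeSet i j = {Edge.mk i j h} := by
  ext e; simp [edgeSet, h]

theorem edgeSet_self (i : ℕ+) : edgeSet i i = ∅ := by
  ext e; simp [edgeSet]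

theorem Edge.mk_right_injective {i j k : ℕ+} {h : i ≠ j} {h' : i ≠ k}
    (heq : Edge.mk i j h = Edge.mk i k h') : j = k :=
  Sym2.congr_right.1 (congrArg Subtype.val heq)

theorem IsRankOne.measure_edgeSet_le (hμ : IsRankOne μ c γ) (i j : ℕ+) :
    μ (edgeSet i j) ≤ ENNReal.ofReal ((i : ℝ) ^ (-γ)) * ENNReal.ofReal (c * (j : ℝ) ^ (-γ)) := by
  by_cases h : i = j
  · subst h; simp [edgeSet_self]
  · rw [edgeSet_of_ne h, hμ, ← ENNReal.ofReal_mul (by positivity),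
      Real.mul_rpow (by positivity) (by positivity)]
    refine le_of_eq (congrArg _ (by ring))

variable [IsProbabilityMeasure μ]

/-- The terms with j ≠ 1 are the masses of the edges at vertex 1, hence sum to at most 1; the
missing loop j = 1 accounts for c. -/
theorem IsRankOne.tsum_le (hμ : IsRankOne μ c γ) :
    ∑' j : ℕ+, ENNReal.ofReal (c * (j : ℝ) ^ (-γ)) ≤ ENNReal.ofReal (c + 1) := by
  rw [ENNReal.tsum_eq_add_tsum_ite 1, ENNReal.ofReal_add hμ.pos.le zero_le_one]
  refine add_le_add (by simp) ?_
  calc _ = ∑' j : ℕ+, μ (edgeSet 1 j) := by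
        refine tsum_congr fun j => ?_
        split_ifs with h
        · subst h; simp [edgeSet_self]
        · rw [edgeSet_of_ne (Ne.symm h), hμ]; simp
    _ = μ (⋃ j, edgeSet 1 j) := by
        refine (measure_iUnion ?_ fun _ => .of_discrete).symm
        rintro j k hjk
        refine Set.disjoint_left.2 ?_
        rintro e ⟨h, rfl⟩ ⟨h', he⟩
        exact hjk (Edge.mk_right_injective he)
    _ ≤ ENNReal.ofReal 1 := by simpa using prob_le_one

theorem IsRankOne.one_lt (hμ : IsRankOne μ c γ) : 1 < γ := by
  have hc := hμ.pos
  have h1 : Summable fun j : ℕ+ => c * (j : ℝ) ^ (-γ) := by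
    have := ENNReal.summable_toReal (ne_top_of_le_ne_top ENNReal.ofReal_ne_top hμ.tsum_le)
    refine this.congr fun j => ENNReal.toReal_ofReal (by positivity)
  have := summable_pnat_rpow.1 ((summable_mul_left_iff hc.ne').1 h1)
  linarith

/-- The total mass of the edges at a vertex `v`. -/
theorem IsRankOne.measureReal_mem_le (hμ : IsRankOne μ c γ) (v : ℕ+) :
    μ.real {f | v ∈ f.1} ≤ (c + 1) * (v : ℝ) ^ (-γ) := by
  have hc := hμ.pos
  refine ENNReal.toReal_le_of_le_ofReal (by positivity) ?_
  have hsub : {f : Edge | v ∈ f.1} ⊆ ⋃ j, edgeSet v j := by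
    rintro ⟨f, hf⟩ ⟨j, rfl⟩
    exact Set.mem_iUnion.2 ⟨j, by simpa using hf, rfl⟩
  calc μ {f | v ∈ f.1} ≤ μ (⋃ j, edgeSet v j) := measure_mono hsub
    _ ≤ ∑' j, μ (edgeSet v j) := measure_iUnion_le _
    _ ≤ ∑' j : ℕ+, ENNReal.ofReal ((v : ℝ) ^ (-γ)) * ENNReal.ofReal (c * (j : ℝ) ^ (-γ)) :=
        ENNReal.tsum_le_tsum fun j => hμ.measure_edgeSet_le v j
    _ ≤ ENNReal.ofReal ((v : ℝ) ^ (-γ)) * ENNReal.ofReal (c + 1) := by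
        rw [ENNReal.tsum_mul_left]
        gcongr
        exact hμ.tsum_le
    _ = _ := by rw [← ENNReal.ofReal_mul (by positivity), mul_comm]

/-- The vertex `⌈b ^ (2 / γ)⌉ + 1 + k`. -/
noncomputable def blockVertex (γ : ℝ) (b k : ℕ) : ℕ+ :=
  Nat.succPNat (⌈(b : ℝ) ^ (2 / γ)⌉₊ + k)

theorem blockVertex_injective (γ : ℝ) (b : ℕ) : Function.Injective (blockVertex γ b) := by
  intro k l h
  have := Nat.succPNat_injective h
  omega

theorem coe_blockVertex (γ : ℝ) (b k : ℕ) :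
    (blockVertex γ b k : ℝ) = ⌈(b : ℝ) ^ (2 / γ)⌉₊ + k + 1 := by
  simp [blockVertex]

theorem rpow_two_div_rpow_neg (hγ : 0 < γ) (b : ℕ) :
    ((b : ℝ) ^ (2 / γ)) ^ (-γ) = 1 / (b : ℝ) ^ 2 := by
  rw [← Real.rpow_mul (by positivity), show 2 / γ * -γ = -(2 : ℕ) by field_simp; norm_num,
    Real.rpow_neg (by positivity), Real.rpow_natCast, one_div]

theorem blockVertex_rpow_le (hγ : 0 < γ) {b : ℕ} (hb : 0 < b) (k : ℕ) :
    (blockVertex γ b k : ℝ) ^ (-γ) ≤ 1 / (b : ℝ) ^ 2 := by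
  have hb' : (0 : ℝ) < b := by exact_mod_cast hb
  rw [← rpow_two_div_rpow_neg hγ]
  refine Real.rpow_le_rpow_of_nonpos (by positivity) ?_ (by linarith)
  rw [coe_blockVertex]
  have := Nat.le_ceil ((b : ℝ) ^ (2 / γ))
  have : (0 : ℝ) ≤ k := by positivity
  linarith

/-- This is where γ ≤ 2 enters: b ≤ b^(2/γ), so 2b consecutive vertices starting near b^(2/γ) stay
within a constant multiple of it. The constant 6 is not sharp. -/
theorem le_blockVertex_rpow (hγ : 0 < γ) (hγ2 : γ ≤ 2) {b k : ℕ} (hk : k < 2 * b) :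
    (6 : ℝ) ^ (-γ) * (1 / (b : ℝ) ^ 2) ≤ (blockVertex γ b k : ℝ) ^ (-γ) := by
  have hb : 1 ≤ b := by omega
  have hb' : (1 : ℝ) ≤ b := by exact_mod_cast hb
  rw [← rpow_two_div_rpow_neg hγ, ← Real.mul_rpow (by norm_num) (by positivity)]
  refine Real.rpow_le_rpow_of_nonpos (by rw [coe_blockVertex]; positivity) ?_ (by linarith)
  rw [coe_blockVertex]
  have h1 := (Nat.ceil_lt_add_one (a := (b : ℝ) ^ (2 / γ)) (by positivity)).le
  have h2 : (k : ℝ) + 1 ≤ 2 * b := by exact_mod_cast hk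
  have h3 : (b : ℝ) ≤ (b : ℝ) ^ (2 / γ) := by
    conv_lhs => rw [← Real.rpow_one (b : ℝ)]
    exact Real.rpow_le_rpow_of_exponent_le hb' ((one_le_div hγ).2 hγ2)
  linarith

/-- The edge joining the `k`-th vertex of the first block and the `l`-th one of the second. -/
noncomputable def blockEdge (γ : ℝ) (b : ℕ) (p : Fin b × Fin b) : Edge :=
  Edge.mk (blockVertex γ b p.1) (blockVertex γ b (b + p.2))
    fun h => by have := blockVertex_injective γ b h; omega

theorem blockEdge_injective (γ : ℝ) (b : ℕ) : Function.Injective (blockEdge γ b) := by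
  rintro ⟨k, l⟩ ⟨k', l'⟩ h
  have h1 := congrArg Subtype.val h
  simp only [blockEdge, Edge.mk, Sym2.eq_iff, (blockVertex_injective γ b).eq_iff] at h1
  ext <;> simp only <;> omega

open Classical in
/-- The edges joining two blocks of `b` vertices. -/
noncomputable def blockEdges (γ : ℝ) (b : ℕ) : Finset Edge :=
  Finset.univ.image (blockEdge γ b)

theorem mem_blockEdges {γ : ℝ} {b : ℕ} {e : Edge} :
    e ∈ blockEdges γ b ↔ ∃ p, blockEdge γ b p = e := by
  simp [blockEdges]

theorem IsRankOne.measureReal_blockEdge (hμ : IsRankOne μ c γ) (b : ℕ) (p : Fin b × Fin b) :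
    μ.real {blockEdge γ b p} = c * ((blockVertex γ b p.1 : ℝ) ^ (-γ) *
      (blockVertex γ b (b + p.2) : ℝ) ^ (-γ)) := by
  have hc := hμ.pos
  rw [measureReal_def, blockEdge, hμ, ENNReal.toReal_ofReal (by positivity),
    Real.mul_rpow (by positivity) (by positivity)]

theorem measureReal_blockEdges (μ : Measure Edge) [IsProbabilityMeasure μ] (γ : ℝ) (b : ℕ) :
    μ.real (blockEdges γ b) = ∑ p, μ.real {blockEdge γ b p} := by
  classical
  rw [← sum_measureReal_singleton, blockEdges, Finset.sum_image (blockEdge_injective γ b).injOn]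

theorem IsRankOne.le_measureReal_blockEdges (hμ : IsRankOne μ c γ) (hγ2 : γ ≤ 2) {b : ℕ}
    (hb : 0 < b) : c * ((6 : ℝ) ^ (-γ)) ^ 2 / (b : ℝ) ^ 2 ≤ μ.real (blockEdges γ b) := by
  have hγ : 0 < γ := by linarith [hμ.one_lt]
  have hc := hμ.pos
  have hb' : (0 : ℝ) < b := by exact_mod_cast hb
  rw [measureReal_blockEdges]
  calc c * ((6 : ℝ) ^ (-γ)) ^ 2 / (b : ℝ) ^ 2
      = ∑ p : Fin b × Fin b, c * (((6 : ℝ) ^ (-γ) * (1 / (b : ℝ) ^ 2)) *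
          ((6 : ℝ) ^ (-γ) * (1 / (b : ℝ) ^ 2))) := by
        simp only [Finset.sum_const, Finset.card_univ, Fintype.card_prod, Fintype.card_fin,
          nsmul_eq_mul]
        push_cast
        field_simp
    _ ≤ _ := Finset.sum_le_sum fun p _ => by
        rw [hμ.measureReal_blockEdge]
        gcongr
        · exact le_blockVertex_rpow hγ hγ2 (by omega)
        · exact le_blockVertex_rpow hγ hγ2 (by omega)

theorem IsRankOne.measureReal_blockEdges_le (hμ : IsRankOne μ c γ) {b : ℕ}
    (hb : 0 < b) : μ.real (blockEdges γ b) ≤ c / (b : ℝ) ^ 2 := by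
  have hγ : 0 < γ := by linarith [hμ.one_lt]
  have hc := hμ.pos
  have hb' : (0 : ℝ) < b := by exact_mod_cast hb
  rw [measureReal_blockEdges]
  calc _ ≤ ∑ p : Fin b × Fin b, c * ((1 / (b : ℝ) ^ 2) * (1 / (b : ℝ) ^ 2)) :=
        Finset.sum_le_sum fun p _ => by
          rw [hμ.measureReal_blockEdge]
          gcongr
          · exact blockVertex_rpow_le hγ hb _
          · exact blockVertex_rpow_le hγ hb _
    _ = _ := by
        simp only [Finset.sum_const, Finset.card_univ, Fintype.card_prod, Fintype.card_fin,
          nsmul_eq_mul]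
        push_cast
        field_simp

theorem IsRankOne.measureReal_blockVertex_mem_le (hμ : IsRankOne μ c γ) {b : ℕ}
    (hb : 0 < b) (k : ℕ) : μ.real {f | blockVertex γ b k ∈ f.1} ≤ (c + 1) / (b : ℝ) ^ 2 := by
  have hγ : 0 < γ := by linarith [hμ.one_lt]
  have hc := hμ.pos
  calc _ ≤ _ := hμ.measureReal_mem_le _
    _ ≤ (c + 1) * (1 / (b : ℝ) ^ 2) := by gcongr; exact blockVertex_rpow_le hγ hb k
    _ = _ := by ring

/-- The constant collects c from the block edges and c + 1 from each of the two endpoints. -/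
theorem IsRankOne.measureReal_rivals_le (hμ : IsRankOne μ c γ) {b : ℕ} (hb : 0 < b)
    {e : Edge} (he : e ∈ blockEdges γ b) :
    μ.real (rivals (blockEdges γ b) e) ≤ (3 * c + 2) / (b : ℝ) ^ 2 := by
  obtain ⟨p, rfl⟩ := mem_blockEdges.1 he
  have hsub : rivals (blockEdges γ b) (blockEdge γ b p) ⊆ (blockEdges γ b : Set Edge) ∪
      ({f | blockVertex γ b p.1 ∈ f.1} ∪ {f | blockVertex γ b (b + p.2) ∈ f.1}) := by
    rintro f (hf | ⟨v, hv, hvf⟩)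
    · exact .inl hf
    · rcases Sym2.mem_iff.1 hv with rfl | rfl
      · exact .inr (.inl hvf)
      · exact .inr (.inr hvf)
  calc _ ≤ _ := measureReal_mono hsub
    _ ≤ _ := measureReal_union_le _ _
    _ ≤ c / (b : ℝ) ^ 2 + ((c + 1) / (b : ℝ) ^ 2 + (c + 1) / (b : ℝ) ^ 2) :=
      add_le_add (hμ.measureReal_blockEdges_le hb) <| (measureReal_union_le _ _).trans <|
        add_le_add (hμ.measureReal_blockVertex_mem_le hb _) (hμ.measureReal_blockVertex_mem_le hb _)
    _ = _ := by ring

theorem IsRankOne.measureReal_touches_le (hμ : IsRankOne μ c γ) {b : ℕ} (hb : 0 < b) :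
    μ.real {f | ∃ e ∈ blockEdges γ b, Touches e f} ≤ 2 * (c + 1) / b := by
  have hb' : (0 : ℝ) < b := by exact_mod_cast hb
  have hsub : {f | ∃ e ∈ blockEdges γ b, Touches e f} ⊆
      ⋃ k ∈ Finset.range (2 * b), {f | blockVertex γ b k ∈ f.1} := by
    rintro f ⟨e, he, v, hv, hvf⟩
    obtain ⟨p, rfl⟩ := mem_blockEdges.1 he
    simp only [Set.mem_iUnion]
    rcases Sym2.mem_iff.1 hv with rfl | rfl
    · exact ⟨p.1, Finset.mem_range.2 (by omega), hvf⟩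
    · exact ⟨b + p.2, Finset.mem_range.2 (by omega), hvf⟩
  calc _ ≤ _ := measureReal_mono hsub (measure_ne_top _ _)
    _ ≤ _ := measureReal_biUnion_finset_le _ _
    _ ≤ ∑ k ∈ Finset.range (2 * b), (c + 1) / (b : ℝ) ^ 2 :=
      Finset.sum_le_sum fun k _ => hμ.measureReal_blockVertex_mem_le hb k
    _ = _ := by
      rw [Finset.sum_const, Finset.card_range, nsmul_eq_mul]
      push_cast
      field_simp

end

/-! ### Conclusion for the two processes -/

section

variable {Ω : Type*} [MeasurableSpace Ω] {P : Measure Ω} [IsProbabilityMeasure P]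
  {μ : Measure Edge} [IsProbabilityMeasure μ] {c γ : ℝ}

theorem IsRandomEdgeSets.ae_frequently_not_connected_of_le_two {Y : ℕ → Ω → Set Edge}
    (h : IsRandomEdgeSets P μ Y) (hμ : IsRankOne μ c γ) (hγ : γ ≤ 2) :
    ∀ᵐ ω ∂P, ∃ᶠ n in atTop, ¬ (graphOf (accumulated (fun k => Y k ω) n)).Connected := by
  have hc := hμ.pos
  -- Enlarging the blocks by L makes the rival mass small enough: L² ≥ L ≥ 4(3c + 2).
  obtain ⟨L, hL⟩ := exists_nat_ge (12 * c + 8)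
  have hL1 : (1 : ℝ) ≤ L := by linarith
  have hL0 : 0 < L := by exact_mod_cast hL1
  have hLpos : (0 : ℝ) < L := by linarith
  refine h.ae_frequently_not_connected (fun d => blockEdges γ (L * d))
    (δ := c * ((6 : ℝ) ^ (-γ)) ^ 2 / (L : ℝ) ^ 2) (R := 2 * (c + 1)) (by positivity) ?_ ?_ ?_
    ⟨_, hμ.ne_zero 1 2 (by decide)⟩
  · intro d hd e he
    have hd' : (0 : ℝ) < d := by exact_mod_cast hd
    refine (hμ.measureReal_rivals_le (Nat.mul_pos hL0 hd) he).trans ?_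
    push_cast
    rw [div_le_div_iff₀ (by positivity) (by positivity)]
    have : 4 * (3 * c + 2) ≤ (L : ℝ) ^ 2 := by nlinarith
    calc (3 * c + 2) * (4 * (d : ℝ) ^ 2) = 4 * (3 * c + 2) * (d : ℝ) ^ 2 := by ring
      _ ≤ (L : ℝ) ^ 2 * (d : ℝ) ^ 2 := by gcongr
      _ = _ := by ring
  · intro d hd
    have hd' : (0 : ℝ) < d := by exact_mod_cast hd
    calc c * ((6 : ℝ) ^ (-γ)) ^ 2 / (L : ℝ) ^ 2
        = (d : ℝ) ^ 2 * (c * ((6 : ℝ) ^ (-γ)) ^ 2 / ((L * d : ℕ) : ℝ) ^ 2) := by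
          push_cast
          field_simp
      _ ≤ _ := by
        gcongr
        exact hμ.le_measureReal_blockEdges hγ (Nat.mul_pos hL0 hd)
  · intro d hd
    have hd' : (0 : ℝ) < d := by exact_mod_cast hd
    refine (hμ.measureReal_touches_le (Nat.mul_pos hL0 hd)).trans ?_
    push_cast
    gcongr
    exact le_mul_of_one_le_left hd'.le hL1

theorem IsEdgeSampling.ae_eventuallyForever_connected {X : ℕ → Ω → Edge}
    (hX : IsEdgeSampling P μ X) (hμ : IsRankOne μ c γ) (hγ : 2 < γ) :
    ∀ᵐ ω ∂P, EventuallyForever (discreteGraph fun n => X n ω) (fun G => G.Connected) := by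
  obtain ⟨Y, hY, hXY⟩ := hX.exists_randomEdgeSets
  filter_upwards [hXY, hY.ae_eventually_connected hμ hγ] with ω h1 ⟨n₀, h2⟩
  refine ⟨n₀, fun n hn => ?_⟩
  rw [h1]
  exact h2 n hn.le _ subset_rfl (accumulated_mono _ n.le_succ)

theorem IsEdgeSampling.ae_not_eventuallyForever_connected {X : ℕ → Ω → Edge}
    (hX : IsEdgeSampling P μ X) (hμ : IsRankOne μ c γ) (hγ : γ ≤ 2) :
    ∀ᵐ ω ∂P, ¬ EventuallyForever (discreteGraph fun n => X n ω) (fun G => G.Connected) := by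
  obtain ⟨Y, hY, hXY⟩ := hX.exists_randomEdgeSets
  filter_upwards [hXY, hY.ae_frequently_not_connected_of_le_two hμ hγ] with ω h1 h2 ⟨n₀, h3⟩
  obtain ⟨n, hn, hn'⟩ := (h2.and_eventually (eventually_gt_atTop n₀)).exists
  exact hn (h1 n ▸ h3 n hn')

theorem IsEdgePoissonization.ae_eventuallyForever_connected {N : Edge → ℝ≥0 → Ω → ℕ}
    (hN : IsEdgePoissonization P μ N) (hμ : IsRankOne μ c γ) (hγ : 2 < γ) :
    ∀ᵐ ω ∂P, EventuallyForever (continuousGraph fun e t => N e t ω)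
      (fun G => G.Connected) := by
  filter_upwards [hN.ae_pos_iff, hN.randomEdgeSets.ae_eventually_connected hμ hγ]
    with ω ⟨h1, hmono⟩ ⟨n₀, h2⟩
  -- The edge set at time t lies between those at ⌊t⌋ and ⌊t⌋ + 1.
  refine ⟨n₀, fun t ht => h2 ⌊t⌋₊ (Nat.le_floor ht.le) _ ?_ ?_⟩
  · rw [← h1]
    exact fun e he => lt_of_lt_of_le he (hmono e (Nat.floor_le zero_le))
  · rw [← h1]
    refine fun e he => lt_of_lt_of_le he (hmono e ?_)
    push_cast
    exact (Nat.lt_floor_add_one t).le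

theorem IsEdgePoissonization.ae_not_eventuallyForever_connected {N : Edge → ℝ≥0 → Ω → ℕ}
    (hN : IsEdgePoissonization P μ N) (hμ : IsRankOne μ c γ) (hγ : γ ≤ 2) :
    ∀ᵐ ω ∂P, ¬ EventuallyForever (continuousGraph fun e t => N e t ω)
      (fun G => G.Connected) := by
  filter_upwards [hN.ae_pos_iff, hN.randomEdgeSets.ae_frequently_not_connected_of_le_two hμ hγ]
    with ω ⟨h1, _⟩ h2 ⟨t₀, h3⟩
  obtain ⟨n, hn, hn'⟩ := (h2.and_eventually (eventually_gt_atTop ⌈t₀⌉₊)).exists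
  rw [← h1] at hn
  exact hn (h3 n (Nat.lt_of_ceil_lt hn'))

/-- If a property holds almost surely under a condition and fails almost surely otherwise, then it
holds almost surely if and only if the condition is satisfied. -/
theorem ae_iff_and_of_ae_of_ae_not {A : Ω → Prop} {C : Prop} (h : C → ∀ᵐ ω ∂P, A ω)
    (h' : ¬ C → ∀ᵐ ω ∂P, ¬ A ω) :
    ((∀ᵐ ω ∂P, A ω) ↔ C) ∧ (¬ C → ∀ᵐ ω ∂P, ¬ A ω) := by
  refine ⟨⟨fun hA => by_contra fun hC => ?_, h⟩, h'⟩
  obtain ⟨ω, h1, h2⟩ := (hA.and (h' hC)).exists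
  exact h2 h1

end

end EdgeGraph

theorem corollary4p2 (γ : ℝ)
    (μ : MeasureTheory.Measure EdgeGraph.Edge) [MeasureTheory.IsProbabilityMeasure μ]
    (hμ : ∃ c : ℝ, ∀ (i j : ℕ+) (h : i ≠ j),
      μ.real {EdgeGraph.Edge.mk i j h} = c * ((i : ℝ) * (j : ℝ)) ^ (-γ)) :
    -- discrete time
    (∀ (Ω : Type*) [MeasurableSpace Ω] (P : MeasureTheory.Measure Ω)
        [MeasureTheory.IsProbabilityMeasure P] (X : ℕ → Ω → EdgeGraph.Edge),
      EdgeGraph.IsEdgeSampling P μ X →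
        ((∀ᵐ ω ∂P, EdgeGraph.EventuallyForever
            (EdgeGraph.discreteGraph fun n => X n ω) (fun G => G.Connected)) ↔ 2 < γ) ∧
        (¬ 2 < γ → ∀ᵐ ω ∂P, ¬ EdgeGraph.EventuallyForever
            (EdgeGraph.discreteGraph fun n => X n ω) (fun G => G.Connected))) ∧
    -- continuous time
    (∀ (Ω : Type*) [MeasurableSpace Ω] (P : MeasureTheory.Measure Ω)
        [MeasureTheory.IsProbabilityMeasure P] (N : EdgeGraph.Edge → NNReal → Ω → ℕ),
      EdgeGraph.IsEdgePoissonization P μ N →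
        ((∀ᵐ ω ∂P, EdgeGraph.EventuallyForever
            (EdgeGraph.continuousGraph fun e t => N e t ω) (fun G => G.Connected)) ↔ 2 < γ) ∧
        (¬ 2 < γ → ∀ᵐ ω ∂P, ¬ EdgeGraph.EventuallyForever
            (EdgeGraph.continuousGraph fun e t => N e t ω) (fun G => G.Connected))) := by
  obtain ⟨c, hc⟩ := hμ
  have hμ : EdgeGraph.IsRankOne μ c γ := fun i j h => by
    rw [← hc i j h, MeasureTheory.ofReal_measureReal]
  exact ⟨fun Ω _ P _ X hX => EdgeGraph.ae_iff_and_of_ae_of_ae_not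
      (hX.ae_eventuallyForever_connected hμ)
      fun hγ => hX.ae_not_eventuallyForever_connected hμ (not_lt.1 hγ),
    fun Ω _ P _ N hN => EdgeGraph.ae_iff_and_of_ae_of_ae_not
      (hN.ae_eventuallyForever_connected hμ)
      fun hγ => hN.ae_not_eventuallyForever_connected hμ (not_lt.1 hγ)⟩
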